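/- Let $a,b,n\ge 1$ be integers, let $\sigma^2>0$ and $\sigma^2_{\alpha\beta}\ge 0$, and consider the balanced two-way model \[ y_{ijk}=\mu+\alpha_i+\beta_j+(\alpha\beta)_{ij}+e_{ijk},\qquad i=1,\dots,a,\ j=1,\dots,b,\ k=1,\dots,n, \] with independent errors $e_{ijk}\sim N(0,\sigma^2)$. Let \[ SS_{AB}=\sum_{i=1}^a\sum_{j=1}^b\sum_{k=1}^n\bigl(\bar y_{ij.}-\bar y_{i..}-\bar y_{.j.}+\bar y_{...}\bigr)^2 ,\qquad \gamma_{AB}=n\sum_{i=1}^a\sum_{j=1}^b\bigl[(\alpha\beta)_{ij}-\overline{(\alpha\beta)}_{i.}-\overline{(\alpha\beta)}_{.j}+\overline{(\alpha\beta)}_{..}\bigr]^2 , \] where a bar and a dot denote the arithmetic mean over the dotted index. Write $\chi^2(p,\lambda)$ for the noncentral chi-square distribution with $p$ degrees of freedom and noncentrality parameter $\lambda$, that is, the law of $(Z_1+\sqrt\lambda)^2+Z_2^2+\dots+Z_p^2$ with $Z_1,\dots,Z_p$ independent standard normal; write $\chi^2(p)=\chi^2(p,0)$ (the point mass at $0$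 if $p=0$), and $c\,\chi^2$ for the law of $c$ times such a variable. (i) If all effects $\alpha_i$, $\beta_j$, $(\alpha\beta)_{ij}$ are fixed (real constants), then $SS_{AB}\sim\sigma^2\chi^2\bigl((a-1)(b-1),\ \gamma_{AB}/\sigma^2\bigr)$. Suppose now that the interaction effects are random, $(\alpha\beta)_{ij}\sim N(0,\sigma^2_{\alpha\beta})$, and that all the $(\alpha\beta)_{ij}$ and $e_{ijk}$ are mutually independent; the main effects $\alpha_i$ and $\beta_j$ may be fixed or random. Then (ii) $\gamma_{AB}\sim n\sigma^2_{\alpha\beta}\,\chi^2\bigl((a-1)(b-1)\bigr)$, and (iii) $SS_{AB}\sim(\sigma^2+n\sigma^2_{\alpha\beta})\,\chi^2\bigl((a-1)(b-1)\bigr)$. -/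

import Mathlib

open MeasureTheory ProbabilityTheory
open scoped NNReal

noncomputable section

namespace TwoWay

/-- The (central) chi-square distribution `χ²(p)`: the law of `Z₁² + ⋯ + Z_p²` for independent
standard normal `Z₁, …, Z_p` (for `p = 0`, the point mass at `0`). -/
def chiSq (p : ℕ) : Measure ℝ :=
  (Measure.pi fun _ : Fin p => gaussianReal 0 1).map fun z => ∑ i, z i ^ 2

/-- The noncentral chi-square distribution `χ²(p, lam)` with noncentrality parameter `lam ≥ 0`:
the law of `(Z₁ + √lam)² + Z₂² + ⋯ + Z_p²` for independent standard normal `Z₁, …, Z_p`. -/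
def noncentralChiSq (p : ℕ) (lam : ℝ) : Measure ℝ :=
  (Measure.pi fun _ : Fin p => gaussianReal 0 1).map fun z =>
    ∑ i : Fin p, (z i + if (i : ℕ) = 0 then √lam else 0) ^ 2

/-- The law of `c * X` when `X` has law `ν`. -/
def scaleLaw (c : ℝ) (ν : Measure ℝ) : Measure ℝ := ν.map fun x => c * x

variable {a b n : ℕ}

/-- The row mean `x̄_{i.}` of a two-way table. -/
def rowMean (x : Fin a → Fin b → ℝ) (i : Fin a) : ℝ := (∑ j, x i j) / b

/-- The column mean `x̄_{.j}` of a two-way table. -/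
def colMean (x : Fin a → Fin b → ℝ) (j : Fin b) : ℝ := (∑ i, x i j) / a

/-- The overall mean `x̄_{..}` of a two-way table. -/
def grandMean (x : Fin a → Fin b → ℝ) : ℝ := (∑ i, ∑ j, x i j) / ((a : ℝ) * b)

/-- `γ_AB = n ∑ᵢ ∑ⱼ (x_{ij} - x̄_{i.} - x̄_{.j} + x̄_{..})²` for a table `x` of interaction effects
and `n` replicates per cell. -/
def gammaAB (n : ℕ) (x : Fin a → Fin b → ℝ) : ℝ :=
  n * ∑ i, ∑ j, (x i j - rowMean x i - colMean x j + grandMean x) ^ 2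

/-- The interaction sum of squares
`SS_AB = ∑ᵢ ∑ⱼ ∑ₖ (ȳ_{ij.} - ȳ_{i..} - ȳ_{.j.} + ȳ_{...})²` of the observations `y_{ijk}`. -/
def ssAB (y : Fin a → Fin b → Fin n → ℝ) : ℝ :=
  ∑ i, ∑ j, ∑ _k : Fin n,
    ((∑ k', y i j k') / n
      - (∑ j', ∑ k', y i j' k') / ((b : ℝ) * n)
      - (∑ i', ∑ k', y i' j k') / ((a : ℝ) * n)
      + (∑ i', ∑ j', ∑ k', y i' j' k') / ((a : ℝ) * b * n)) ^ 2

/-- The observations `y_{ijk} = μ + α_i + β_j + (αβ)_{ij} + e_{ijk}` of the two-way model. -/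
def response (mu : ℝ) (α : Fin a → ℝ) (β : Fin b → ℝ) (ab : Fin a → Fin b → ℝ)
    (e : Fin a → Fin b → Fin n → ℝ) (i : Fin a) (j : Fin b) (k : Fin n) : ℝ :=
  mu + α i + β j + ab i j + e i j k

end TwoWay

end

/-!
Let `C_a`, `C_b` be the centering matrices of sizes `a` and `b`. The interaction residuals of a
two-way table are its image under `C_a ⊗ C_b`, an orthogonal projection of trace
`(a - 1) * (b - 1)` that annihilates additive tables. Hence `SS_AB` is `n` times the squared norm of
the projection of the table `(αβ)_{ij} + ē_{ij.}`: the main effects drop out. The entries of this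
table are independent normal variables of common variance `σ² / n` (fixed interaction) or
`σ²_{αβ} + σ² / n` (random interaction). In an orthonormal basis of the range of the projection
whose first vector points along the projected mean, the coordinates are again independent normal
variables of that variance, centered except for the first one, so that the squared norm is a scaled
noncentral chi-square variable.
-/

namespace TwoWay

open Matrix
open scoped Kronecker

section GaussianVectors

variable {ι σ : Type*} [Fintype σ]

lemma measurable_mulVec (C : Matrix ι σ ℝ) : Measurable fun x => C *ᵥ x := by
  unfold mulVec dotProduct
  fun_prop

variable [Fintype ι]

lemma charFun_map_mulVec (C : Matrix ι σ ℝ) (μ : Measure (σ → ℝ)) (t : EuclideanSpace ℝ ι) :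
    charFun ((μ.map fun x => C *ᵥ x).map (WithLp.toLp 2)) t =
      charFun (μ.map (WithLp.toLp 2)) (WithLp.toLp 2 (Cᵀ *ᵥ t.ofLp)) := by
  rw [Measure.map_map (by fun_prop) (measurable_mulVec C), charFun_apply, charFun_apply,
    integral_map ((WithLp.measurable_toLp ..).comp (measurable_mulVec C)).aemeasurable
      (by fun_prop), integral_map (by fun_prop) (by fun_prop)]
  simp only [Function.comp_apply, EuclideanSpace.inner_eq_star_dotProduct, star_trivial,
    dotProduct_mulVec, vecMul_transpose, dotProduct_comm]

variable [DecidableEq σ]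

lemma prod_charFun_gaussianReal (m : σ → ℝ) (w : σ → ℝ≥0) (t : σ → ℝ) :
    ∏ s, charFun (gaussianReal (m s) (w s)) (t s) = Complex.exp
      ((t ⬝ᵥ m : ℝ) * Complex.I - (t ⬝ᵥ diagonal (fun s => (w s : ℝ)) *ᵥ t : ℝ) / 2) := by
  simp only [charFun_gaussianReal, ← Complex.exp_sum, Finset.sum_sub_distrib, ← Finset.sum_mul,
    ← Finset.sum_div, dotProduct, mulVec_diagonal]
  push_cast
  simp only [sq, mul_left_comm]

lemma hasLaw_mulVec_pi_gaussianReal [DecidableEq ι] {C : Matrix ι σ ℝ} {w : σ → ℝ≥0}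
    {v : ι → ℝ≥0}
    (hC : C * diagonal (fun s => (w s : ℝ)) * Cᵀ = diagonal fun i => (v i : ℝ)) (m : σ → ℝ) :
    HasLaw (fun x => C *ᵥ x) (Measure.pi fun i => gaussianReal ((C *ᵥ m) i) (v i))
      (Measure.pi fun s => gaussianReal (m s) (w s)) := by
  refine ⟨(measurable_mulVec C).aemeasurable, ?_⟩
  have := Measure.isProbabilityMeasure_map (μ := Measure.pi fun s => gaussianReal (m s) (w s))
    (measurable_mulVec C).aemeasurable
  refine charFun_eq_pi_iff.1 fun t => ?_
  have hmean : (Cᵀ *ᵥ t.ofLp) ⬝ᵥ m = t.ofLp ⬝ᵥ C *ᵥ m := by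
    rw [mulVec_transpose, dotProduct_mulVec]
  have hvar : (Cᵀ *ᵥ t.ofLp) ⬝ᵥ diagonal (fun s => (w s : ℝ)) *ᵥ (Cᵀ *ᵥ t.ofLp) =
      t.ofLp ⬝ᵥ diagonal (fun i => (v i : ℝ)) *ᵥ t.ofLp := by
    rw [← hC, ← mulVec_mulVec, ← mulVec_mulVec, dotProduct_mulVec t.ofLp, mulVec_transpose]
  rw [charFun_map_mulVec, charFun_pi, prod_charFun_gaussianReal, prod_charFun_gaussianReal,
    hmean, hvar]

lemma hasLaw_const_add_pi_gaussianReal (m d : ι → ℝ) (v : ι → ℝ≥0) :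
    HasLaw (fun x => d + x) (Measure.pi fun i => gaussianReal (m i + d i) (v i))
      (Measure.pi fun i => gaussianReal (m i) (v i)) := by
  have h (i) : (gaussianReal (m i) (v i)).map (d i + ·) = gaussianReal (m i + d i) (v i) :=
    gaussianReal_map_const_add (d i)
  have (i : ι) : SigmaFinite ((gaussianReal (m i) (v i)).map (d i + ·)) := by
    rw [h]; infer_instance
  simp only [← h]
  exact ⟨by fun_prop, Measure.pi_map_pi (f := fun i x => d i + x) fun i => by fun_prop⟩

lemma hasLaw_sum_sq_pi_gaussianReal (p : ℕ) (v : ℝ≥0) (lam : ℝ) :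
    HasLaw (fun z => ∑ i, z i ^ 2) (scaleLaw v (noncentralChiSq p lam))
      (Measure.pi fun i : Fin p => gaussianReal (if (i : ℕ) = 0 then √(v * lam) else 0) v) := by
  let δ (i : Fin p) : ℝ := if (i : ℕ) = 0 then √lam else 0
  have hC : √v • (1 : Matrix (Fin p) (Fin p) ℝ) * diagonal (fun _ => ((1 : ℝ≥0) : ℝ)) *
      (√v • (1 : Matrix (Fin p) (Fin p) ℝ))ᵀ = diagonal fun _ => (v : ℝ) := by
    simp [smul_one_eq_diagonal]
  have hδ (i) : ((√v • (1 : Matrix (Fin p) (Fin p) ℝ)) *ᵥ fun i => 0 + δ i) i =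
      if (i : ℕ) = 0 then √(v * lam) else 0 := by
    simp [smul_mulVec, δ]
  have h := (hasLaw_mulVec_pi_gaussianReal hC fun i => 0 + δ i).comp
    (hasLaw_const_add_pi_gaussianReal 0 δ fun _ => 1)
  simp only [hδ] at h
  have hsq : Measurable fun z : Fin p → ℝ => ∑ i, z i ^ 2 := by fun_prop
  refine ⟨hsq.aemeasurable, ?_⟩
  rw [← h.map_eq, AEMeasurable.map_map_of_aemeasurable hsq.aemeasurable h.aemeasurable, scaleLaw,
    noncentralChiSq, Measure.map_map (by fun_prop) (by fun_prop)]
  congr 1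
  ext z
  simp only [Function.comp_apply, smul_mulVec, one_mulVec, Pi.smul_apply, Pi.add_apply, smul_eq_mul,
    mul_pow, Real.sq_sqrt v.coe_nonneg, ← Finset.mul_sum, add_comm, δ]

end GaussianVectors

lemma noncentralChiSq_zero (p : ℕ) : noncentralChiSq p 0 = chiSq p := by
  simp [noncentralChiSq, chiSq]

lemma scaleLaw_scaleLaw (c d : ℝ) (ν : Measure ℝ) :
    scaleLaw c (scaleLaw d ν) = scaleLaw (c * d) ν := by
  rw [scaleLaw, scaleLaw, scaleLaw, Measure.map_map (by fun_prop) (by fun_prop)]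
  simp only [Function.comp_def, mul_assoc]

section Projections

lemma exists_orthonormalBasis_inner_eq {V : Type*} [NormedAddCommGroup V] [InnerProductSpace ℝ V]
    [FiniteDimensional ℝ V] {p : ℕ} (hp : Module.finrank ℝ V = p) (m : V) :
    ∃ B : OrthonormalBasis (Fin p) ℝ V, ∀ i : Fin p,
      inner ℝ (B i) m = if (i : ℕ) = 0 then ‖m‖ else 0 := by
  by_cases hm : m = 0
  · exact ⟨(stdOrthonormalBasis ℝ V).reindex (finCongr hp), fun i => by simp [hm]⟩
  have hm' : ‖m‖ ≠ 0 := norm_ne_zero_iff.2 hm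
  have hv : Orthonormal ℝ (({i : Fin p | (i : ℕ) = 0} : Set (Fin p)).domRestrict
      fun _ => ‖m‖⁻¹ • m) := by
    refine ⟨fun i => by simp [norm_smul, hm'], fun i j hij => ?_⟩
    exact absurd (Subtype.ext (Fin.ext (i.2.trans j.2.symm))) hij
  obtain ⟨B, hB⟩ := hv.exists_orthonormalBasis_extension_of_card_eq (by simpa using hp)
  refine ⟨B, fun i => ?_⟩
  have hp0 : 0 < p := i.pos
  have h0 : B ⟨0, hp0⟩ = ‖m‖⁻¹ • m := hB _ rfl
  have hm0 : m = ‖m‖ • B ⟨0, hp0⟩ := by rw [h0, smul_smul, mul_inv_cancel₀ hm', one_smul]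
  rw [hm0, inner_smul_right, orthonormal_iff_ite.1 B.orthonormal, norm_smul, B.norm_eq_one]
  simp [Fin.ext_iff]

lemma sum_inner_sq_eq_norm_starProjection_sq {E τ : Type*} [NormedAddCommGroup E]
    [InnerProductSpace ℝ E] [Fintype τ] {U : Submodule ℝ E} [U.HasOrthogonalProjection]
    (B : OrthonormalBasis τ ℝ U) (x : E) :
    ∑ i, inner ℝ (B i : E) x ^ 2 = ‖U.starProjection x‖ ^ 2 := by
  rw [Submodule.starProjection_apply, ← Submodule.coe_norm, ← B.sum_sq_norm_inner_right]
  simp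

variable {ι : Type*} [Fintype ι] {M : Matrix ι ι ℝ}

lemma exists_mulVec_eq_starProjection (hM : IsStarProjection M) :
    ∃ U : Submodule ℝ (EuclideanSpace ℝ ι), M.trace = Module.finrank ℝ U ∧
      ∀ x, WithLp.toLp 2 (M *ᵥ x) = U.starProjection (WithLp.toLp 2 x) := by
  classical
  have hT := hM.map (toEuclideanCLM (n := ι) (𝕜 := ℝ))
  have hidem := ContinuousLinearMap.isIdempotentElem_toLinearMap_iff.2 hT.isIdempotentElem
  obtain ⟨_, hU⟩ := isStarProjection_iff_eq_starProjection_range.1 hT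
  refine ⟨_, ?_, fun x => DFunLike.congr_fun hU (WithLp.toLp 2 x)⟩
  rw [← (LinearMap.IsIdempotentElem.isProj_range _ hidem).trace,
    coe_toEuclideanCLM_eq_toEuclideanLin, toEuclideanLin,
    toLpLin_eq_toLin, trace_toLin_eq]

lemma exists_orthonormal_rows_sum_mulVec_sq_eq (hM : IsStarProjection M) {p : ℕ}
    (hp : M.trace = p) (m : ι → ℝ) :
    ∃ B : Matrix (Fin p) ι ℝ, B * Bᵀ = 1 ∧
      (∀ x, ∑ i, (B *ᵥ x) i ^ 2 = ∑ i, (M *ᵥ x) i ^ 2) ∧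
      ∀ i, (B *ᵥ m) i = if (i : ℕ) = 0 then √(∑ j, (M *ᵥ m) j ^ 2) else 0 := by
  obtain ⟨U, hU, hMU⟩ := exists_mulVec_eq_starProjection hM
  obtain ⟨b, hb⟩ := exists_orthonormalBasis_inner_eq (p := p) (by exact_mod_cast hU.symm.trans hp)
    (U.orthogonalProjectionOnto (WithLp.toLp 2 m))
  let B : Matrix (Fin p) ι ℝ := of fun i => (b i : EuclideanSpace ℝ ι).ofLp
  have hB (x : ι → ℝ) (i) : (B *ᵥ x) i = inner ℝ (b i : EuclideanSpace ℝ ι) (WithLp.toLp 2 x) := by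
    simp [B, mulVec, dotProduct, PiLp.inner_apply, mul_comm]
  have hnorm (x : ι → ℝ) : ‖U.starProjection (WithLp.toLp 2 x)‖ ^ 2 = ∑ i, (M *ᵥ x) i ^ 2 := by
    simp [← hMU, EuclideanSpace.real_norm_sq_eq]
  refine ⟨B, ?_, fun x => ?_, fun i => ?_⟩
  · ext i j
    rw [one_apply, ← orthonormal_iff_ite.1 b.orthonormal i j, Submodule.coe_inner]
    simp [B, mul_apply, PiLp.inner_apply, mul_comm]
  · simp only [hB, sum_inner_sq_eq_norm_starProjection_sq, hnorm]
  · rw [hB, ← hnorm, Real.sqrt_sq (norm_nonneg _), Submodule.starProjection_apply,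
      ← Submodule.coe_norm, ← hb, Submodule.inner_orthogonalProjectionOnto_eq_of_mem_left]

lemma hasLaw_sum_mulVec_sq {Ω : Type*} [MeasurableSpace Ω] {P : Measure Ω} (hM : IsStarProjection M)
    {p : ℕ} (hp : M.trace = p) {W : Ω → ι → ℝ} {m : ι → ℝ} {v : ℝ≥0} {lam : ℝ}
    (hW : HasLaw W (Measure.pi fun i => gaussianReal (m i) v) P)
    (hlam : ∑ i, (M *ᵥ m) i ^ 2 = v * lam) :
    HasLaw (fun ω => ∑ i, (M *ᵥ W ω) i ^ 2) (scaleLaw v (noncentralChiSq p lam)) P := by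
  classical
  obtain ⟨B, hB, hBM, hBm⟩ := exists_orthonormal_rows_sum_mulVec_sq_eq hM hp m
  have hvar : B * (diagonal fun _ => (v : ℝ) : Matrix ι ι ℝ) * Bᵀ = diagonal fun _ => (v : ℝ) := by
    simp [← smul_one_eq_diagonal, hB]
  have hBW := (hasLaw_mulVec_pi_gaussianReal hvar m).comp hW
  simp only [hBm, hlam] at hBW
  simp only [← hBM]
  exact (hasLaw_sum_sq_pi_gaussianReal p v lam).comp hBW

end Projections

section Interaction

variable (ι κ : Type*) [Fintype ι] [Fintype κ]

variable {ι κ} in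
lemma kronecker_mulVec_apply {ι' κ' : Type*} (A : Matrix ι' ι ℝ) (B : Matrix κ' κ ℝ) (x : ι × κ → ℝ)
    (i : ι') (j : κ') :
    ((A ⊗ₖ B) *ᵥ x) (i, j) = (A *ᵥ fun s => (B *ᵥ fun t => x (s, t)) j) i := by
  simp [mulVec, dotProduct, Fintype.sum_prod_type, Finset.mul_sum, mul_assoc]

variable [DecidableEq ι] [DecidableEq κ]

/-- The matrix subtracting from a vector its arithmetic mean. -/
noncomputable def centering : Matrix ι ι ℝ := 1 - of fun _ _ => (Fintype.card ι : ℝ)⁻¹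

/-- The matrix centering a two-way table, encoded as a vector indexed by the cells, within its rows
and within its columns; its values are the interaction residuals. -/
noncomputable def interaction : Matrix (ι × κ) (ι × κ) ℝ := centering ι ⊗ₖ centering κ

lemma isStarProjection_centering : IsStarProjection (centering ι) := by
  refine IsStarProjection.one_sub ⟨?_, rfl⟩
  ext i j
  have : Nonempty ι := ⟨i⟩
  simp [mul_apply]

lemma trace_centering : (centering ι).trace = (Fintype.card ι - 1 : ℕ) := by
  cases isEmpty_or_nonempty ι
  · simp
  · simp [centering, trace, Nat.cast_pred Fintype.card_pos]

lemma isStarProjection_interaction : IsStarProjection (interaction ι κ) := by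
  have hι := isStarProjection_centering ι
  have hκ := isStarProjection_centering κ
  refine ⟨?_, ?_⟩
  · rw [interaction, IsIdempotentElem, ← mul_kronecker_mul, hι.isIdempotentElem,
      hκ.isIdempotentElem]
  · rw [interaction, IsSelfAdjoint, star_eq_conjTranspose, conjTranspose_kronecker,
      ← star_eq_conjTranspose, ← star_eq_conjTranspose, hι.isSelfAdjoint, hκ.isSelfAdjoint]

lemma trace_interaction :
    (interaction ι κ).trace = ((Fintype.card ι - 1) * (Fintype.card κ - 1) : ℕ) := by
  rw [interaction, trace_kronecker, trace_centering, trace_centering, Nat.cast_mul]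

variable {ι κ}

lemma centering_mulVec_apply (x : ι → ℝ) (i : ι) :
    (centering ι *ᵥ x) i = x i - (∑ j, x j) / Fintype.card ι := by
  rw [centering, sub_mulVec, one_mulVec, Pi.sub_apply]
  simp [mulVec, dotProduct, ← Finset.sum_div, inv_mul_eq_div]

lemma interaction_mulVec_additive (u : ι → ℝ) (w : κ → ℝ) :
    interaction ι κ *ᵥ (fun q => u q.1 + w q.2) = 0 := by
  ext ⟨i, j⟩
  have : Nonempty ι := ⟨i⟩
  have : Nonempty κ := ⟨j⟩
  simp only [interaction, kronecker_mulVec_apply, centering_mulVec_apply, Finset.sum_add_distrib,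
    Finset.sum_sub_distrib, Finset.sum_const, Finset.card_univ, nsmul_eq_mul, add_div,
    ← Finset.sum_div, Pi.zero_apply]
  field_simp
  simp only [← Finset.mul_sum]
  ring

end Interaction

section Tables

variable {a b n : ℕ}

lemma interaction_mulVec_apply (x : Fin a → Fin b → ℝ) (i : Fin a) (j : Fin b) :
    (interaction (Fin a) (Fin b) *ᵥ fun q => x q.1 q.2) (i, j) =
      x i j - rowMean x i - colMean x j + grandMean x := by
  simp only [interaction, kronecker_mulVec_apply, centering_mulVec_apply, Fintype.card_fin, rowMean,
    colMean, grandMean, Finset.sum_sub_distrib, ← Finset.sum_div, mul_comm (a : ℝ), ← div_div]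
  ring

lemma gammaAB_eq_sum_interaction_mulVec_sq (n : ℕ) (x : Fin a → Fin b → ℝ) :
    gammaAB n x = n * ∑ p, (interaction (Fin a) (Fin b) *ᵥ fun q => x q.1 q.2) p ^ 2 := by
  simp only [gammaAB, Fintype.sum_prod_type, interaction_mulVec_apply]

lemma gammaAB_additive_add (n : ℕ) (u : Fin a → ℝ) (w : Fin b → ℝ) (x : Fin a → Fin b → ℝ) :
    gammaAB n (fun i j => (u i + w j) + x i j) = gammaAB n x := by
  simp only [gammaAB_eq_sum_interaction_mulVec_sq]
  have h := mulVec_add (interaction (Fin a) (Fin b)) (fun q => u q.1 + w q.2) fun q => x q.1 q.2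
  rw [interaction_mulVec_additive, zero_add] at h
  rw [← h]
  rfl

lemma ssAB_eq_gammaAB_cellMean (y : Fin a → Fin b → Fin n → ℝ) :
    ssAB y = gammaAB n fun i j => (∑ k, y i j k) / n := by
  simp only [ssAB, gammaAB, rowMean, colMean, grandMean, ← Finset.sum_div, div_div,
    Finset.sum_const, Finset.card_univ, Fintype.card_fin, nsmul_eq_mul, ← Finset.mul_sum]
  simp only [mul_comm (n : ℝ)]

lemma ssAB_response (mu : ℝ) (α : Fin a → ℝ) (β : Fin b → ℝ) (ab : Fin a → Fin b → ℝ)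
    (e : Fin a → Fin b → Fin n → ℝ) :
    ssAB (response mu α β ab e) = gammaAB n fun i j => ab i j + (∑ k, e i j k) / n := by
  obtain rfl | hn := eq_or_ne n 0
  · simp [ssAB, gammaAB]
  have hmean : (fun i j => (∑ k, response mu α β ab e i j k) / n) =
      fun i j => ((mu + α i) + β j) + (ab i j + (∑ k, e i j k) / n) := by
    ext i j
    simp only [response, Finset.sum_add_distrib, Finset.sum_const, Finset.card_univ,
      Fintype.card_fin, nsmul_eq_mul]
    field_simp
    ring
  rw [ssAB_eq_gammaAB_cellMean, hmean, gammaAB_additive_add n fun i => mu + α i]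

end Tables

section CellMeans

variable (ι κ : Type*) [Fintype ι] [Fintype κ] [DecidableEq ι]

/-- The matrix averaging over the second index, which takes observations to cell means. -/
noncomputable def averaging : Matrix ι (ι × κ) ℝ :=
  of fun i q => if q.1 = i then (Fintype.card κ : ℝ)⁻¹ else 0

lemma averaging_mul_transpose :
    averaging ι κ * (averaging ι κ)ᵀ = (Fintype.card κ : ℝ)⁻¹ • (1 : Matrix ι ι ℝ) := by
  ext i j
  have : Fintype.card κ * ((Fintype.card κ : ℝ)⁻¹ * (Fintype.card κ : ℝ)⁻¹) =
      (Fintype.card κ : ℝ)⁻¹ := by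
    grind
  simp [averaging, mul_apply, Fintype.sum_prod_type_right, one_apply, eq_comm (a := j), this]

variable {ι κ}

lemma averaging_mulVec_apply (x : ι × κ → ℝ) (i : ι) :
    (averaging ι κ *ᵥ x) i = (∑ k, x (i, k)) / Fintype.card κ := by
  simp [averaging, mulVec, dotProduct, Fintype.sum_prod_type_right, ← Finset.sum_div,
    inv_mul_eq_div]

end CellMeans

section CellMeanLaws

variable {ι κ : Type*} [Fintype ι] [Fintype κ] {Ω : Type*} [MeasurableSpace Ω] {P : Measure Ω}
  {u v : ℝ≥0} {U : ι → Ω → ℝ} {E : ι × κ → Ω → ℝ}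

lemma hasLaw_const_add_mean (hE : ∀ q, HasLaw (E q) (gaussianReal 0 v) P) (hindep : iIndepFun E P)
    (d : ι → ℝ) :
    HasLaw (fun ω i => d i + (∑ k, E (i, k) ω) / Fintype.card κ)
      (Measure.pi fun i => gaussianReal (d i) (v / Fintype.card κ)) P := by
  classical
  have hvar : averaging ι κ * (diagonal fun _ => (v : ℝ) : Matrix (ι × κ) (ι × κ) ℝ) *
      (averaging ι κ)ᵀ = diagonal fun _ => ((v / Fintype.card κ : ℝ≥0) : ℝ) := by
    simp [← smul_one_eq_diagonal, averaging_mul_transpose, smul_smul, div_eq_mul_inv]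
  have h := (hasLaw_const_add_pi_gaussianReal _ d _).comp
    ((hasLaw_mulVec_pi_gaussianReal hvar 0).comp (hindep.hasLaw_pi hE))
  convert h using 1
  · ext ω i
    simp [averaging_mulVec_apply]
  · simp

lemma hasLaw_add_mean (hU : ∀ i, HasLaw (U i) (gaussianReal 0 u) P)
    (hE : ∀ q, HasLaw (E q) (gaussianReal 0 v) P) (hindep : iIndepFun (Sum.elim U E) P) :
    HasLaw (fun ω i => U i ω + (∑ k, E (i, k) ω) / Fintype.card κ)
      (Measure.pi fun _ => gaussianReal 0 (u + v / Fintype.card κ)) P := by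
  classical
  let w : ι ⊕ ι × κ → ℝ≥0 := Sum.elim (fun _ => u) fun _ => v
  have hlaw (s : ι ⊕ ι × κ) : HasLaw (Sum.elim U E s) (gaussianReal 0 (w s)) P := by
    rcases s with i | q
    exacts [hU i, hE q]
  let C : Matrix ι (ι ⊕ ι × κ) ℝ := fromCols 1 (averaging ι κ)
  have hvar : C * (diagonal fun s => (w s : ℝ) : Matrix (ι ⊕ ι × κ) (ι ⊕ ι × κ) ℝ) * Cᵀ =
      diagonal fun _ => ((u + v / Fintype.card κ : ℝ≥0) : ℝ) := by
    have hw : (diagonal fun s => (w s : ℝ) : Matrix (ι ⊕ ι × κ) (ι ⊕ ι × κ) ℝ) =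
        fromBlocks ((u : ℝ) • 1) 0 0 ((v : ℝ) • 1) := by
      rw [smul_one_eq_diagonal, smul_one_eq_diagonal, fromBlocks_diagonal]
      congr 1 with (i | q) <;> rfl
    rw [hw, transpose_fromCols, fromCols_mul_fromBlocks, fromCols_mul_fromRows]
    simp [averaging_mul_transpose, smul_smul, ← smul_one_eq_diagonal, div_eq_mul_inv, add_smul]
  have h := (hasLaw_mulVec_pi_gaussianReal hvar 0).comp (hindep.hasLaw_pi hlaw)
  convert h using 1
  · ext ω i
    simp [C, fromCols_mulVec, averaging_mulVec_apply, Function.comp_def]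
  · simp

end CellMeanLaws

section InteractionLaws

variable {a b : ℕ} {Ω : Type*} [MeasurableSpace Ω] {P : Measure Ω} {W : Fin a → Fin b → Ω → ℝ}
  {v : ℝ≥0}

lemma hasLaw_gammaAB (n : ℕ) {m : Fin a → Fin b → ℝ} {lam : ℝ}
    (hW : HasLaw (fun ω p => W p.1 p.2 ω)
      (Measure.pi fun p : Fin a × Fin b => gaussianReal (m p.1 p.2) v) P)
    (hlam : gammaAB 1 m = v * lam) :
    HasLaw (fun ω => gammaAB n fun i j => W i j ω)
      (scaleLaw (n * v) (noncentralChiSq ((a - 1) * (b - 1)) lam)) P := by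
  simp only [gammaAB_eq_sum_interaction_mulVec_sq] at hlam ⊢
  have h := hasLaw_sum_mulVec_sq (isStarProjection_interaction (Fin a) (Fin b))
    (p := (a - 1) * (b - 1)) (by simp [trace_interaction]) hW (by simpa using hlam)
  rw [← scaleLaw_scaleLaw]
  exact HasLaw.comp ⟨by fun_prop, rfl⟩ h

lemma hasLaw_gammaAB_of_mean_zero (n : ℕ)
    (hW : HasLaw (fun ω p => W p.1 p.2 ω)
      (Measure.pi fun _ : Fin a × Fin b => gaussianReal 0 v) P) :
    HasLaw (fun ω => gammaAB n fun i j => W i j ω)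
      (scaleLaw (n * v) (chiSq ((a - 1) * (b - 1)))) P := by
  rw [← noncentralChiSq_zero]
  exact hasLaw_gammaAB n (m := 0) hW (by simp [gammaAB, rowMean, colMean, grandMean])

lemma hasLaw_ssAB_response {n : ℕ} (hn : n ≠ 0) (mu : ℝ) (α : Fin a → ℝ) (β : Fin b → ℝ)
    (ab : Fin a → Fin b → ℝ) {e : Fin a → Fin b → Fin n → Ω → ℝ} (hv : v ≠ 0)
    (he : ∀ i j k, HasLaw (e i j k) (gaussianReal 0 v) P)
    (hindep : iIndepFun (fun q : (Fin a × Fin b) × Fin n => e q.1.1 q.1.2 q.2) P) :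
    HasLaw (fun ω => ssAB (response mu α β ab fun i j k => e i j k ω))
      (scaleLaw v (noncentralChiSq ((a - 1) * (b - 1)) (gammaAB n ab / v))) P := by
  have hcell := hasLaw_const_add_mean (fun _ => he _ _ _) hindep fun p => ab p.1 p.2
  rw [Fintype.card_fin] at hcell
  have hlam : gammaAB 1 ab = (v / n : ℝ≥0) * (gammaAB n ab / v) := by
    simp only [gammaAB]
    push_cast
    field_simp
  have hscale : (v : ℝ) = n * (v / n : ℝ≥0) := by
    push_cast
    field_simp
  simp only [ssAB_response]
  nth_rw 1 [hscale]
  exact hasLaw_gammaAB n (W := fun i j ω => ab i j + (∑ k, e i j k ω) / n) hcell hlam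

lemma hasLaw_ssAB_response_of_random {n : ℕ} (hn : n ≠ 0) (mu : ℝ)
    (α : Fin a → Ω → ℝ) (β : Fin b → Ω → ℝ) {ab : Fin a → Fin b → Ω → ℝ}
    {e : Fin a → Fin b → Fin n → Ω → ℝ} {u : ℝ≥0}
    (hab : ∀ i j, HasLaw (ab i j) (gaussianReal 0 u) P)
    (he : ∀ i j k, HasLaw (e i j k) (gaussianReal 0 v) P)
    (hindep : iIndepFun (Sum.elim (fun p : Fin a × Fin b => ab p.1 p.2)
      fun q : (Fin a × Fin b) × Fin n => e q.1.1 q.1.2 q.2) P) :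
    HasLaw (fun ω => ssAB (response mu (fun i => α i ω) (fun j => β j ω) (fun i j => ab i j ω)
        fun i j k => e i j k ω))
      (scaleLaw (v + n * u) (chiSq ((a - 1) * (b - 1)))) P := by
  have hcell := hasLaw_add_mean (fun p : Fin a × Fin b => hab p.1 p.2) (fun _ => he _ _ _) hindep
  rw [Fintype.card_fin] at hcell
  have hscale : (v + n * u : ℝ) = n * (u + v / n : ℝ≥0) := by
    push_cast
    field_simp
    ring
  simp only [ssAB_response, hscale]
  exact hasLaw_gammaAB_of_mean_zero n (W := fun i j ω => ab i j ω + (∑ k, e i j k ω) / n) hcell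

end InteractionLaws

end TwoWay

theorem mainTheorem4 {Ω : Type*} [MeasurableSpace Ω] (P : Measure Ω) [IsProbabilityMeasure P]
    (a b n : ℕ) (ha : 1 ≤ a) (hb : 1 ≤ b) (hn : 1 ≤ n)
    -- the variance components `σ²` (errors) and `σ²_{αβ}` (interaction)
    (vE vAB : ℝ≥0) (hvE : 0 < vE)
    -- the overall mean, and the main effects: constants, or random with any joint law
    (mu : ℝ) (α : Fin a → Ω → ℝ) (β : Fin b → Ω → ℝ)
    -- the random interaction effects and the errors
    (ab : Fin a → Fin b → Ω → ℝ) (e : Fin a → Fin b → Fin n → Ω → ℝ)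
    (hab : ∀ i j, HasLaw (ab i j) (gaussianReal 0 vAB) P)
    (he : ∀ i j k, HasLaw (e i j k) (gaussianReal 0 vE) P)
    -- all interaction effects and all errors are mutually independent
    (hindep : iIndepFun
      (Sum.elim (fun p : Fin a × Fin b => ab p.1 p.2)
        (fun q : Fin a × Fin b × Fin n => e q.1 q.2.1 q.2.2)) P) :
    -- for fixed effects, `γ_AB / σ²` is the noncentrality parameter of `SS_AB / σ²`
    (∀ (α₀ : Fin a → ℝ) (β₀ : Fin b → ℝ) (ab₀ : Fin a → Fin b → ℝ),
      HasLaw (fun ω => TwoWay.ssAB (TwoWay.response mu α₀ β₀ ab₀ fun i j k => e i j k ω))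
        (TwoWay.scaleLaw vE
          (TwoWay.noncentralChiSq ((a - 1) * (b - 1)) (TwoWay.gammaAB n ab₀ / vE))) P) ∧
    -- the law of `γ_AB` for random interaction effects
    HasLaw (fun ω => TwoWay.gammaAB n fun i j => ab i j ω)
      (TwoWay.scaleLaw (n * vAB) (TwoWay.chiSq ((a - 1) * (b - 1)))) P ∧
    -- the law of `SS_AB` for random interaction effects
    HasLaw (fun ω => TwoWay.ssAB
        (TwoWay.response mu (fun i => α i ω) (fun j => β j ω) (fun i j => ab i j ω)
          fun i j k => e i j k ω))
      (TwoWay.scaleLaw (vE + n * vAB) (TwoWay.chiSq ((a - 1) * (b - 1)))) P := by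
  have hn₀ : n ≠ 0 := Nat.one_le_iff_ne_zero.1 hn
  have hall : iIndepFun (Sum.elim (fun p : Fin a × Fin b => ab p.1 p.2)
      fun q : (Fin a × Fin b) × Fin n => e q.1.1 q.1.2 q.2) P := by
    convert hindep.precomp ((Equiv.refl _).sumCongr (Equiv.prodAssoc _ _ _)).injective using 1
    ext (p | q) <;> rfl
  exact ⟨fun α₀ β₀ ab₀ => TwoWay.hasLaw_ssAB_response hn₀ mu α₀ β₀ ab₀ hvE.ne' he
      (hall.precomp Sum.inr_injective),
    TwoWay.hasLaw_gammaAB_of_mean_zero n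
      ((hindep.precomp Sum.inl_injective).hasLaw_pi fun p : Fin a × Fin b => hab p.1 p.2),
    TwoWay.hasLaw_ssAB_response_of_random hn₀ mu α β hab he hall⟩
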